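/- Let $N\ge 0$ and let $S=\sum_{n=1}^{N}|n\rangle\langle N+1-n|$ be the $N\times N$ mirror operator. Let $A$ be a tridiagonal Hermitian $N\times N$ matrix which is mirror-symmetric, i.e. $A=SAS$. Then $A$ is arbitrarily close to a perfect state transfer solution: for every $\varepsilon>0$ there is a tridiagonal, Hermitian, mirror-symmetric $N\times N$ matrix $A'$, real if $A$ is real, with $|A'_{ij}-A_{ij}|<\varepsilon$ for all $i,j$, such that $A'$ has perfect state transfer: there are a time $t_0>0$ and a phase $\varphi\in\mathbb{R}$ with $$e^{-it_0A'}\Psi=e^{i\varphi}\,S\Psi\qquad\text{for all }\Psi\in\mathbb{C}^N ,$$ so that in particular $e^{-it_0A'}|1\rangle=e^{i\varphi}|N\rangle$ when $N\ge 1$. -/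

import Mathlib

/-- A square matrix is tridiagonal if its entries vanish off the main diagonal and the two
diagonals next to it. -/
def IsTridiagonal {N : ℕ} (A : Matrix (Fin N) (Fin N) ℂ) : Prop :=
  ∀ i j : Fin N, ((i : ℕ) + 1 < (j : ℕ) ∨ (j : ℕ) + 1 < (i : ℕ)) → A i j = 0

/-- The mirror operator `∑ₙ |n⟩⟨N + 1 - n|`; here the sites are numbered `0, …, N - 1`,
and `Fin.rev i` is the site `N - 1 - i`. -/
def mirror (N : ℕ) : Matrix (Fin N) (Fin N) ℂ :=
  Matrix.of fun i j => if j = Fin.rev i then 1 else 0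

/-- A matrix is (mirror-)symmetric if it is invariant under conjugation by the mirror operator. -/
def IsMirrorSymmetric {N : ℕ} (A : Matrix (Fin N) (Fin N) ℂ) : Prop :=
  A = mirror N * A * mirror N

/-- Perfect state transfer: at some positive time `t₀` the evolution `exp (-i t₀ A)` takes every
state `Ψ` to its mirror image, up to one global phase `exp (i φ)`. In particular it takes the
first site to the last one. -/
def HasPerfectStateTransfer {N : ℕ} (A : Matrix (Fin N) (Fin N) ℂ) : Prop :=
  ∃ t₀ : ℝ, 0 < t₀ ∧ ∃ φ : ℝ, ∀ Ψ : Fin N → ℂ,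
    Matrix.mulVec (NormedSpace.exp ((-Complex.I * (t₀ : ℂ)) • A)) Ψ =
      Complex.exp (Complex.I * (φ : ℂ)) • Matrix.mulVec (mirror N) Ψ

/-!
A mirror-symmetric matrix `A` commutes with the mirror operator, so its eigenvectors can be taken
symmetric or antisymmetric. If, for some `δ > 0`, every eigenvalue with a symmetric eigenvector lies
in `δ · 2ℤ` and every eigenvalue with an antisymmetric one lies in `δ (2ℤ + 1)`, then
`exp (-i (π / δ) A)` is the mirror operator (`hasPerfectStateTransfer_of_eigenvalues`). The task is to
move the eigenvalues of the two sectors to these lattices by a small change of `A`.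

After a perturbation no entry next to the diagonal vanishes. Let `q k` be the polynomials of the
three-term recurrence with parameters `a k = A k k` and `c k = |A k (k + 1)| ^ 2` (`jacobiPoly`). The
entries of an eigenvector are multiples of the values `q k (λ)`, and its symmetry gives a boundary
condition at the middle of the chain, so that `λ` is a root of `p₊` or of `p₋`:
* if `N = 2 (m + 1)`, then `p₊ = q (m + 1) - β q m` and `p₋ = q (m + 1) + β q m`, where `β` is the
  (real) entry joining the two middle sites;
* if `N = 2 m + 1`, then `p₋ = q m` and `p₊ = q (m + 1) - c (m - 1) q (m - 1)`, which becomes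
  `q (m + 1)` once the parameter `c (m - 1)` is doubled.

In all cases `p₊` and `p₋` are themselves Jacobi polynomials with positive `c`, hence real-rooted,
because the ratio `q (k + 1) / q k` preserves the upper half-plane (`jacobiPoly.splits`). Their roots
can thus be rounded to the lattices, which for small `δ` changes the coefficients little
(`exists_coeffTendsto_rounded_roots`). Conversely, the Euclidean algorithm recovers the parameters
`a` and `c` (and `β`) continuously from two consecutive Jacobi polynomials
(`exists_tendsto_eventually_jacobiPoly_eq`), so the rounded pair is realized by parameters close to
the original ones. Putting the new diagonal into `A` and rescaling its off-diagonal entries by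
positive factors close to `1`, symmetrically under the mirror (`mirrorDeform`), gives the matrix
sought; the factors being real, phases and reality are preserved. Neither the simplicity of the
spectrum nor the interlacing of the roots of `p₊` and `p₋` plays a role.
-/

open Polynomial Filter Topology

/-! ### Jacobi polynomials -/

/-- The monic polynomials given by the three-term recurrence
`q (k + 2) = (X - a (k + 1)) q (k + 1) - c k q k`, `q 0 = 1`, `q 1 = X - a 0`. For a Hermitian
tridiagonal matrix with diagonal `a` and superdiagonal `b`, and `c k = ‖b k‖ ^ 2`, these are the
characteristic polynomials of the leading principal submatrices. -/
noncomputable def jacobiPoly (a c : ℕ → ℝ) : ℕ → ℝ[X]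
  | 0 => 1
  | 1 => X - C (a 0)
  | k + 2 => (X - C (a (k + 1))) * jacobiPoly a c (k + 1) - C (c k) * jacobiPoly a c k

namespace jacobiPoly

variable {a c a' c' : ℕ → ℝ}

theorem monic_and_natDegree (a c : ℕ → ℝ) (n : ℕ) :
    (jacobiPoly a c n).Monic ∧ (jacobiPoly a c n).natDegree = n := by
  induction n using Nat.twoStepInduction with
  | zero => simp [jacobiPoly]
  | one => simp [jacobiPoly, monic_X_sub_C]
  | more k ih0 ih1 =>
    have hm : ((X - C (a (k + 1))) * jacobiPoly a c (k + 1)).Monic :=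
      (monic_X_sub_C _).mul ih1.1
    have hd : ((X - C (a (k + 1))) * jacobiPoly a c (k + 1)).natDegree = k + 2 := by
      rw [(monic_X_sub_C _).natDegree_mul ih1.1, ih1.2, natDegree_X_sub_C]; ring
    have hlt : (C (c k) * jacobiPoly a c k).degree <
        ((X - C (a (k + 1))) * jacobiPoly a c (k + 1)).degree := by
      rw [degree_eq_natDegree hm.ne_zero, hd]
      refine lt_of_le_of_lt (degree_le_of_natDegree_le
        ((natDegree_C_mul_le _ _).trans ih0.2.le)) ?_
      exact_mod_cast (by omega : k < k + 2)
    refine ⟨hm.sub_of_left hlt, ?_⟩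
    rw [jacobiPoly, natDegree_eq_of_degree_eq (degree_sub_eq_left_of_degree_lt hlt), hd]

theorem monic (a c : ℕ → ℝ) (n : ℕ) : (jacobiPoly a c n).Monic := (monic_and_natDegree a c n).1

theorem natDegree_eq (a c : ℕ → ℝ) (n : ℕ) : (jacobiPoly a c n).natDegree = n :=
  (monic_and_natDegree a c n).2

theorem congr {n : ℕ} (ha : ∀ k < n, a k = a' k) (hc : ∀ k, k + 1 < n → c k = c' k) :
    jacobiPoly a c n = jacobiPoly a' c' n := by
  induction n using Nat.twoStepInduction with
  | zero => rfl
  | one => simp [jacobiPoly, ha 0]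
  | more k ih0 ih1 =>
    rw [jacobiPoly, jacobiPoly, ih0 (fun j hj => ha j (by omega)) (fun j hj => hc j (by omega)),
      ih1 (fun j hj => ha j (by omega)) (fun j hj => hc j (by omega)), ha _ (by omega),
      hc _ (by omega)]

/-- The ratio of consecutive Jacobi polynomials maps the upper half-plane to itself: it satisfies
`f (k + 1) = z - a (k + 1) - c k / f k`, and `w ↦ -1 / w` preserves the upper half-plane. -/
theorem aeval_ne_zero_and_im_div_pos {z : ℂ} (hz : 0 < z.im) {n : ℕ}
    (hc : ∀ k < n, 0 < c k) :
    aeval z (jacobiPoly a c n) ≠ 0 ∧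
      0 < (aeval z (jacobiPoly a c (n + 1)) / aeval z (jacobiPoly a c n)).im := by
  induction n with
  | zero => simpa [jacobiPoly] using hz
  | succ n ih =>
    obtain ⟨h0, him⟩ := ih fun k hk => hc k (by omega)
    have h1 : aeval z (jacobiPoly a c (n + 1)) ≠ 0 := by
      intro h
      simp [h] at him
    refine ⟨h1, ?_⟩
    set f := aeval z (jacobiPoly a c (n + 1)) / aeval z (jacobiPoly a c n) with hf
    have hstep : aeval z (jacobiPoly a c (n + 2)) / aeval z (jacobiPoly a c (n + 1)) =
        z - (a (n + 1) : ℂ) - (c n : ℂ) * f⁻¹ := by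
      rw [jacobiPoly, hf]
      simp only [map_sub, map_mul, aeval_X, aeval_C, Complex.coe_algebraMap]
      field_simp
    have hfn : 0 < Complex.normSq f := Complex.normSq_pos.2 fun h => by simp [h] at him
    have hpos : 0 < c n * (f.im / Complex.normSq f) :=
      mul_pos (hc n (by omega)) (div_pos him hfn)
    rw [hstep, Complex.sub_im, Complex.sub_im, Complex.im_ofReal_mul, Complex.inv_im,
      Complex.ofReal_im, neg_div, mul_neg]
    linarith

/-- Jacobi polynomials with positive parameters `c` are real-rooted. -/
theorem splits {n : ℕ} (hc : ∀ k, k + 1 < n → 0 < c k) : (jacobiPoly a c n).Splits := by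
  have key : ∀ z : ℂ, 0 < z.im → aeval z (jacobiPoly a c n) ≠ 0 := by
    intro z hz
    cases n with
    | zero => simp [jacobiPoly]
    | succ n =>
      intro h
      have := (aeval_ne_zero_and_im_div_pos (a := a) (c := c) hz
        (n := n) fun k hk => hc k (by omega)).2
      simp [h] at this
  refine Splits.of_splits_map (algebraMap ℝ ℂ) (IsAlgClosed.splits _) fun z hz => ?_
  have hroot : aeval z (jacobiPoly a c n) = 0 := by
    have := (mem_roots'.1 hz).2
    rwa [IsRoot.def, eval_map_algebraMap] at this
  refine ⟨z.re, ?_⟩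
  rcases lt_trichotomy z.im 0 with h | h | h
  · refine absurd ?_ (key (starRingEnd ℂ z) (by simpa using h))
    rw [aeval_conj, hroot, map_zero]
  · exact Complex.ext rfl (by simp [h])
  · exact absurd hroot (key z h)

end jacobiPoly

/-- Subtracting a multiple of the previous Jacobi polynomial amounts to shifting the last diagonal
parameter. -/
theorem jacobiPoly_succ_sub_C_mul (a c : ℕ → ℝ) (m : ℕ) (t : ℝ) :
    jacobiPoly a c (m + 1) - C t * jacobiPoly a c m =
      jacobiPoly (Function.update a m (a m + t)) c (m + 1) := by
  have h : ∀ k ≤ m, jacobiPoly (Function.update a m (a m + t)) c k = jacobiPoly a c k :=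
    fun k hk => jacobiPoly.congr (fun j hj => Function.update_of_ne (by omega) _ _)
      fun _ _ => rfl
  cases m with
  | zero => simp [jacobiPoly]; ring
  | succ m =>
    rw [jacobiPoly, jacobiPoly, h _ le_rfl, h _ (by omega), Function.update_self, C_add]
    ring

/-! ### Coefficientwise convergence of polynomials -/

/-- Coefficientwise convergence of a family of real polynomials along a filter. -/
def CoeffTendsto {ι : Type*} (P : ι → ℝ[X]) (l : Filter ι) (p : ℝ[X]) : Prop :=
  ∀ k, Tendsto (fun i => (P i).coeff k) l (𝓝 (p.coeff k))

namespace CoeffTendsto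

variable {ι : Type*} {l : Filter ι} {P Q : ι → ℝ[X]} {p q : ℝ[X]}

theorem const (p : ℝ[X]) : CoeffTendsto (fun _ : ι => p) l p := fun _ => tendsto_const_nhds

theorem sub (hP : CoeffTendsto P l p) (hQ : CoeffTendsto Q l q) :
    CoeffTendsto (fun i => P i - Q i) l (p - q) := fun k => by
  simpa using (hP k).sub (hQ k)

theorem add (hP : CoeffTendsto P l p) (hQ : CoeffTendsto Q l q) :
    CoeffTendsto (fun i => P i + Q i) l (p + q) := fun k => by
  simpa using (hP k).add (hQ k)

theorem mul (hP : CoeffTendsto P l p) (hQ : CoeffTendsto Q l q) :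
    CoeffTendsto (fun i => P i * Q i) l (p * q) := fun k => by
  simp only [coeff_mul]
  exact tendsto_finsetSum _ fun x _ => (hP _).mul (hQ _)

theorem C {x : ι → ℝ} {y : ℝ} (h : Tendsto x l (𝓝 y)) :
    CoeffTendsto (fun i => C (x i)) l (C y) := fun k => by
  by_cases hk : k = 0 <;> simp [coeff_C, hk, h, tendsto_const_nhds]

end CoeffTendsto

/-- The points `δ (2 n + s)`, where `2 δ n` is the multiple of `2 δ` nearest to `x`, converge to `x`
as `δ → 0+`. -/
theorem tendsto_mul_two_mul_round_add (s : ℤ) (x : ℝ) :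
    Tendsto (fun δ : ℝ => δ * (2 * (round (x / (2 * δ)) : ℤ) + s)) (𝓝[>] 0) (𝓝 x) := by
  have hlim : Tendsto (fun δ : ℝ => δ * (1 + |(s : ℝ)|)) (𝓝[>] 0) (𝓝 0) := by
    have : Tendsto (fun δ : ℝ => δ * (1 + |(s : ℝ)|)) (𝓝 0) (𝓝 (0 * (1 + |(s : ℝ)|))) :=
      tendsto_id.mul_const _
    rw [zero_mul] at this
    exact this.mono_left nhdsWithin_le_nhds
  rw [tendsto_iff_dist_tendsto_zero]
  refine squeeze_zero' (Eventually.of_forall fun _ => dist_nonneg) ?_ hlim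
  filter_upwards [self_mem_nhdsWithin] with δ (hδ : 0 < δ)
  have h := abs_sub_round (x / (2 * δ))
  have heq : δ * (2 * (round (x / (2 * δ)) : ℤ) + s) - x =
      δ * (s - 2 * (x / (2 * δ) - (round (x / (2 * δ)) : ℤ))) := by
    field_simp
    ring
  rw [Real.dist_eq, heq, abs_mul, abs_of_pos hδ]
  refine mul_le_mul_of_nonneg_left ((abs_sub _ _).trans ?_) hδ.le
  rw [abs_mul, abs_two]
  linarith

/-- A monic real-rooted polynomial is a coefficientwise limit, as `δ → 0+`, of monic polynomials
all of whose roots lie in `δ (2ℤ + s)`: round every root to such a point. -/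
theorem exists_coeffTendsto_rounded_roots {p : ℝ[X]} (hp : p.Splits) (hm : p.Monic) (s : ℤ) :
    ∃ P : ℝ → ℝ[X], (∀ δ, (P δ).Monic) ∧ (∀ δ, (P δ).natDegree = p.natDegree) ∧
      (∀ δ x, (P δ).IsRoot x → ∃ n : ℤ, x = δ * (2 * n + s)) ∧ CoeffTendsto P (𝓝[>] 0) p := by
  obtain ⟨ρ, hρ, hlim⟩ : ∃ ρ : ℝ → ℝ → ℝ, (∀ δ x, ∃ n : ℤ, ρ δ x = δ * (2 * n + s)) ∧
      ∀ x, Tendsto (fun δ => ρ δ x) (𝓝[>] 0) (𝓝 x) :=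
    ⟨_, fun δ x => ⟨round (x / (2 * δ)), rfl⟩, tendsto_mul_two_mul_round_add s⟩
  have hPlim : ∀ S : Multiset ℝ, CoeffTendsto (fun δ => (S.map fun x => X - C (ρ δ x)).prod)
      (𝓝[>] 0) (S.map fun x => X - C x).prod := by
    intro S
    induction S using Multiset.induction with
    | empty => simpa using CoeffTendsto.const 1
    | cons x S ih =>
      simp only [Multiset.map_cons, Multiset.prod_cons]
      exact ((CoeffTendsto.const X).sub (CoeffTendsto.C (hlim x))).mul ih
  refine ⟨fun δ => (p.roots.map fun x => X - C (ρ δ x)).prod,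
    fun δ => monic_multiset_prod_of_monic _ _ fun _ _ => monic_X_sub_C _,
    fun δ => ?_, fun δ x hx => ?_, ?_⟩
  · rw [natDegree_multiset_prod_of_monic _ fun f hf => by
      obtain ⟨y, -, rfl⟩ := Multiset.mem_map.1 hf
      exact monic_X_sub_C _, Multiset.map_map]
    simp [hp.natDegree_eq_card_roots]
  · rw [IsRoot.def, eval_multiset_prod, Multiset.prod_eq_zero_iff, Multiset.map_map,
      Multiset.mem_map] at hx
    obtain ⟨y, -, hy⟩ := hx
    obtain ⟨n, hn⟩ := hρ δ y
    refine ⟨n, hn ▸ ?_⟩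
    simpa [sub_eq_zero] using hy
  · have := hPlim p.roots
    rwa [← hp.eq_prod_roots_of_monic hm] at this

/-- Stability of the Euclidean algorithm on two consecutive Jacobi polynomials: two polynomials
coefficientwise close to them are again consecutive Jacobi polynomials, with close parameters. -/
theorem exists_tendsto_eventually_jacobiPoly_eq {ι : Type*} {l : Filter ι} {a c : ℕ → ℝ} {n : ℕ}
    (hc : ∀ k < n, c k ≠ 0) {P Q : ι → ℝ[X]}
    (hP : CoeffTendsto P l (jacobiPoly a c (n + 1))) (hQ : CoeffTendsto Q l (jacobiPoly a c n))
    (hPm : ∀ᶠ i in l, (P i).Monic ∧ (P i).natDegree = n + 1)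
    (hQm : ∀ᶠ i in l, (Q i).Monic ∧ (Q i).natDegree = n) :
    ∃ a' c' : ι → ℕ → ℝ, (∀ k, Tendsto (fun i => a' i k) l (𝓝 (a k))) ∧
      (∀ k, Tendsto (fun i => c' i k) l (𝓝 (c k))) ∧
      ∀ᶠ i in l, jacobiPoly (a' i) (c' i) (n + 1) = P i ∧ jacobiPoly (a' i) (c' i) n = Q i := by
  induction n generalizing P Q with
  | zero =>
    refine ⟨fun i => Function.update a 0 (-(P i).coeff 0), fun _ => c, fun k => ?_,
      fun k => tendsto_const_nhds, ?_⟩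
    · rcases eq_or_ne k 0 with rfl | hk
      · simpa [jacobiPoly] using (hP 0).neg
      · simpa [hk] using tendsto_const_nhds
    · filter_upwards [hPm, hQm] with i hi hj
      refine ⟨?_, ?_⟩
      · have h1 : (P i).coeff 1 = 1 := by simpa [hi.2] using hi.1.coeff_natDegree
        rw [eq_X_add_C_of_natDegree_le_one (p := P i) (by rw [hi.2]), h1]
        simp [jacobiPoly]
      · simp [jacobiPoly, hj.1.natDegree_eq_zero.1 hj.2]
  | succ n ih =>
    let α : ι → ℝ := fun i => (Q i).coeff n - (P i).coeff (n + 1)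
    have hα : Tendsto α l (𝓝 (a (n + 1))) := by
      have h := (hQ n).sub (hP (n + 1))
      have h1 : (jacobiPoly a c (n + 1)).coeff (n + 1) = 1 := by
        simpa [jacobiPoly.natDegree_eq] using (jacobiPoly.monic a c (n + 1)).coeff_natDegree
      have h2 : (jacobiPoly a c n).coeff (n + 1) = 0 :=
        coeff_eq_zero_of_natDegree_lt (by simp [jacobiPoly.natDegree_eq])
      simpa [jacobiPoly, sub_mul, coeff_X_mul, h1, h2] using h
    let R : ι → ℝ[X] := fun i => (X - C (α i)) * Q i - P i
    have hR : CoeffTendsto R l (C (c n) * jacobiPoly a c n) := by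
      have h := (((CoeffTendsto.const X).sub (CoeffTendsto.C hα)).mul hQ).sub hP
      simpa [jacobiPoly] using h
    have hRd : ∀ᶠ i in l, (R i).natDegree ≤ n := by
      filter_upwards [hPm, hQm] with i hi hj
      have hQ1 : (Q i).coeff (n + 1) = 1 := by simpa [hj.2] using hj.1.coeff_natDegree
      have hP1 : (P i).coeff (n + 2) = 1 := by simpa [hi.2] using hi.1.coeff_natDegree
      rw [natDegree_le_iff_coeff_eq_zero]
      intro k hk
      obtain ⟨j, rfl⟩ : ∃ j, k = n + 1 + j := ⟨k - (n + 1), by omega⟩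
      rcases j with _ | _ | j
      · simp [R, α, sub_mul, coeff_X_mul, hQ1]
      · have : (Q i).coeff (n + 2) = 0 := coeff_eq_zero_of_natDegree_lt (by omega)
        simp [R, α, sub_mul, coeff_X_mul, hQ1, hP1, this]
      · have h1 : (Q i).coeff (n + 1 + (j + 1)) = 0 := coeff_eq_zero_of_natDegree_lt (by omega)
        have h2 : (Q i).coeff (n + 1 + (j + 1) + 1) = 0 :=
          coeff_eq_zero_of_natDegree_lt (by omega)
        have h3 : (P i).coeff (n + 1 + (j + 1) + 1) = 0 :=
          coeff_eq_zero_of_natDegree_lt (by omega)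
        simp [R, ← add_assoc, sub_mul, coeff_X_mul] at h1 h2 h3 ⊢
        simp [h1, h2, h3]
    let γ : ι → ℝ := fun i => (R i).coeff n
    have hγ : Tendsto γ l (𝓝 (c n)) := by
      have h1 : (jacobiPoly a c n).coeff n = 1 := by
        simpa [jacobiPoly.natDegree_eq] using (jacobiPoly.monic a c n).coeff_natDegree
      simpa [h1] using hR n
    have hcn : c n ≠ 0 := hc n (by omega)
    have hγ0 : ∀ᶠ i in l, γ i ≠ 0 := hγ.eventually_ne hcn
    have hQ' : CoeffTendsto (fun i => C (γ i)⁻¹ * R i) l (jacobiPoly a c n) := by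
      have h := (CoeffTendsto.C (hγ.inv₀ hcn)).mul hR
      rwa [← mul_assoc, ← C_mul, inv_mul_cancel₀ hcn, C_1, one_mul] at h
    have hQm' : ∀ᶠ i in l, (C (γ i)⁻¹ * R i).Monic ∧ (C (γ i)⁻¹ * R i).natDegree = n := by
      filter_upwards [hRd, hγ0] with i hi h0
      have h1 : (C (γ i)⁻¹ * R i).coeff n = 1 := by
        rw [coeff_C_mul]; exact inv_mul_cancel₀ h0
      have hle : (C (γ i)⁻¹ * R i).natDegree ≤ n := (natDegree_C_mul_le _ _).trans hi
      exact ⟨monic_of_natDegree_le_of_coeff_eq_one n hle h1,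
        natDegree_eq_of_le_of_coeff_ne_zero hle (by rw [h1]; exact one_ne_zero)⟩
    obtain ⟨a', c', ha', hc', h⟩ := ih (fun k hk => hc k (by omega)) hQ hQ' hQm hQm'
    refine ⟨fun i => Function.update (a' i) (n + 1) (α i), fun i => Function.update (c' i) n (γ i),
      fun k => ?_, fun k => ?_, ?_⟩
    · rcases eq_or_ne k (n + 1) with rfl | hk
      · simpa using hα
      · simpa [hk] using ha' k
    · rcases eq_or_ne k n with rfl | hk
      · simpa using hγ
      · simpa [hk] using hc' k
    · filter_upwards [h, hγ0] with i hi h0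
      have hcongr : ∀ m ≤ n + 1, jacobiPoly (Function.update (a' i) (n + 1) (α i))
          (Function.update (c' i) n (γ i)) m = jacobiPoly (a' i) (c' i) m := fun m hm =>
        jacobiPoly.congr
          (fun k hk => Function.update_of_ne (by omega) _ _)
          (fun k hk => Function.update_of_ne (by omega) _ _)
      refine ⟨?_, by rw [hcongr _ le_rfl, hi.1]⟩
      rw [jacobiPoly, hcongr _ le_rfl, hcongr _ (by omega), hi.1, hi.2, Function.update_self,
        Function.update_self, ← mul_assoc, ← C_mul, mul_inv_cancel₀ h0, C_1, one_mul]
      simp [R]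

/-! ### Mirror symmetry and perfect state transfer -/

section Mirror

variable {N : ℕ} {A : Matrix (Fin N) (Fin N) ℂ}

theorem mirror_mulVec (v : Fin N → ℂ) : (mirror N).mulVec v = v ∘ Fin.rev := by
  ext i
  simp [_root_.mirror, Matrix.mulVec, dotProduct]

theorem isMirrorSymmetric_iff : IsMirrorSymmetric A ↔ ∀ i j, A i j = A i.rev j.rev := by
  have h : mirror N * A * mirror N = Matrix.of fun i j => A i.rev j.rev := by
    ext i j
    have hrev : ∀ k : Fin N, j = k.rev ↔ k = j.rev := fun k => by
      rw [← Fin.rev_inj, Fin.rev_rev, eq_comm]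
    simp [_root_.mirror, Matrix.mul_apply, hrev]
  rw [IsMirrorSymmetric, h, ← Matrix.ext_iff]
  rfl

theorem IsMirrorSymmetric.mulVec_comp_rev (hA : IsMirrorSymmetric A) (v : Fin N → ℂ) :
    A.mulVec (v ∘ Fin.rev) = A.mulVec v ∘ Fin.rev := by
  ext i
  simp only [Matrix.mulVec, dotProduct, Function.comp_apply]
  rw [← Equiv.sum_comp Fin.revPerm]
  refine Finset.sum_congr rfl fun j _ => ?_
  rw [Fin.revPerm_apply, Fin.rev_rev, isMirrorSymmetric_iff.1 hA i j.rev, Fin.rev_rev]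

theorem exp_mulVec_of_mulVec_eq_smul {M : Matrix (Fin N) (Fin N) ℂ} {v : Fin N → ℂ} {μ : ℂ}
    (h : M.mulVec v = μ • v) : (NormedSpace.exp M).mulVec v = Complex.exp μ • v := by
  let : NormedRing (Matrix (Fin N) (Fin N) ℂ) := Matrix.linftyOpNormedRing
  let : NormedAlgebra ℂ (Matrix (Fin N) (Fin N) ℂ) := Matrix.linftyOpNormedAlgebra
  have hpow : ∀ n : ℕ, (M ^ n).mulVec v = μ ^ n • v := by
    intro n
    induction n with
    | zero => simp
    | succ n ih =>
      rw [pow_succ, ← Matrix.mulVec_mulVec, h, Matrix.mulVec_smul, ih, smul_smul, pow_succ']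
  have h1 := NormedSpace.exp_series_hasSum_exp' (𝕂 := ℂ) M
  have h2 := (NormedSpace.exp_series_hasSum_exp' (𝕂 := ℂ) μ).smul_const v
  have hcont : Continuous fun B : Matrix (Fin N) (Fin N) ℂ => B.mulVec v := by fun_prop
  have h3 := h1.map (⟨⟨fun B => B.mulVec v, Matrix.zero_mulVec v⟩,
    fun B B' => Matrix.add_mulVec B B' v⟩ : Matrix (Fin N) (Fin N) ℂ →+ (Fin N → ℂ)) hcont
  rw [Complex.exp_eq_exp_ℂ]
  refine h3.unique ?_
  convert h2 using 2 with n
  simp [Matrix.smul_mulVec, hpow, smul_smul]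

/-- A Hermitian mirror-symmetric matrix has perfect state transfer at time `π / δ` as soon as
`exp (-i (π / δ) λ)` is `1` for the eigenvalues `λ` with a symmetric eigenvector and `-1` for those
with an antisymmetric one. -/
theorem hasPerfectStateTransfer_of_eigenvalues (hA : A.IsHermitian) (hS : IsMirrorSymmetric A)
    {δ : ℝ} (hδ : 0 < δ)
    (hsymm : ∀ (x : ℝ) (v : Fin N → ℂ), v ≠ 0 → A.mulVec v = (x : ℂ) • v → v ∘ Fin.rev = v →
      ∃ n : ℤ, x = δ * (2 * n))
    (hanti : ∀ (x : ℝ) (v : Fin N → ℂ), v ≠ 0 → A.mulVec v = (x : ℂ) • v → v ∘ Fin.rev = -v →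
      ∃ n : ℤ, x = δ * (2 * n + 1)) :
    HasPerfectStateTransfer A := by
  have hδ' : (δ : ℂ) ≠ 0 := by exact_mod_cast hδ.ne'
  refine ⟨Real.pi / δ, div_pos Real.pi_pos hδ, 0, fun Ψ => ?_⟩
  set E := NormedSpace.exp ((-Complex.I * ((Real.pi / δ : ℝ) : ℂ)) • A) with hE
  have hexp : ∀ (x : ℝ) (v : Fin N → ℂ), A.mulVec v = (x : ℂ) • v →
      E.mulVec v = Complex.exp (-Complex.I * ((Real.pi / δ : ℝ) : ℂ) * x) • v := fun x v hv =>
    exp_mulVec_of_mulVec_eq_smul (by rw [Matrix.smul_mulVec, hv, smul_smul])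
  have hplus : ∀ (x : ℝ) (v : Fin N → ℂ), A.mulVec v = (x : ℂ) • v → v ∘ Fin.rev = v →
      E.mulVec v = v ∘ Fin.rev := by
    intro x v hv hr
    rcases eq_or_ne v 0 with rfl | h0
    · ext; simp
    obtain ⟨n, rfl⟩ := hsymm x v h0 hv hr
    rw [hexp _ v hv, hr]
    have : -Complex.I * ((Real.pi / δ : ℝ) : ℂ) * ((δ * (2 * n) : ℝ) : ℂ) =
        ((-n : ℤ) : ℂ) * (2 * Real.pi * Complex.I) := by
      push_cast
      field_simp
    rw [this, Complex.exp_int_mul_two_pi_mul_I, one_smul]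
  have hminus : ∀ (x : ℝ) (v : Fin N → ℂ), A.mulVec v = (x : ℂ) • v → v ∘ Fin.rev = -v →
      E.mulVec v = v ∘ Fin.rev := by
    intro x v hv hr
    rcases eq_or_ne v 0 with rfl | h0
    · ext; simp
    obtain ⟨n, rfl⟩ := hanti x v h0 hv hr
    rw [hexp _ v hv, hr]
    have : -Complex.I * ((Real.pi / δ : ℝ) : ℂ) * ((δ * (2 * n + 1) : ℝ) : ℂ) =
        ((-n - 1 : ℤ) : ℂ) * (2 * Real.pi * Complex.I) + Real.pi * Complex.I := by
      push_cast
      field_simp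
      ring
    rw [this, Complex.exp_add, Complex.exp_int_mul_two_pi_mul_I, Complex.exp_pi_mul_I]
    simp
  -- An arbitrary eigenvector is the half-sum of its symmetric and antisymmetric parts.
  have heig : ∀ (x : ℝ) (v : Fin N → ℂ), A.mulVec v = (x : ℂ) • v →
      E.mulVec v = v ∘ Fin.rev := by
    intro x v hv
    have hv' : A.mulVec (v ∘ Fin.rev) = (x : ℂ) • (v ∘ Fin.rev) := by
      rw [hS.mulVec_comp_rev, hv]; rfl
    have h1 := hplus x (v + v ∘ Fin.rev) (by rw [Matrix.mulVec_add, hv, hv', smul_add])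
      (by ext i; simp [add_comm])
    have h2 := hminus x (v - v ∘ Fin.rev) (by rw [Matrix.mulVec_sub, hv, hv', smul_sub])
      (by ext i; simp)
    rw [Matrix.mulVec_add] at h1
    rw [Matrix.mulVec_sub] at h2
    ext i
    have e1 := congrFun h1 i
    have e2 := congrFun h2 i
    simp only [Pi.add_apply, Pi.sub_apply, Function.comp_apply] at e1 e2 ⊢
    linear_combination (e1 + e2) / 2
  have hlin : E.mulVecLin = (mirror N).mulVecLin := by
    refine (hA.eigenvectorBasis.toBasis.map (WithLp.linearEquiv 2 ℂ (Fin N → ℂ))).ext fun j => ?_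
    simp only [Module.Basis.map_apply, OrthonormalBasis.coe_toBasis, Matrix.mulVecLin_apply,
      WithLp.linearEquiv_apply, mirror_mulVec]
    refine heig (hA.eigenvalues j) _ ?_
    exact (hA.mulVec_eigenvectorBasis j).trans (by ext; simp)
  simpa using LinearMap.congr_fun hlin Ψ

end Mirror

/-! ### Eigenvectors of tridiagonal matrices -/

section Tridiagonal

variable {N : ℕ} {A : Matrix (Fin N) (Fin N) ℂ}

/-- The entries of a matrix over `Fin N`, indexed by natural numbers and zero out of range. -/
def matEntry (A : Matrix (Fin N) (Fin N) ℂ) (i j : ℕ) : ℂ :=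
  if h : i < N ∧ j < N then A ⟨i, h.1⟩ ⟨j, h.2⟩ else 0

/-- The entries of a vector over `Fin N`, indexed by natural numbers and zero out of range. -/
def vecEntry (v : Fin N → ℂ) (i : ℕ) : ℂ := if h : i < N then v ⟨i, h⟩ else 0

@[simp]
theorem matEntry_val (i j : Fin N) : matEntry A i j = A i j := by simp [matEntry]

@[simp]
theorem vecEntry_val (v : Fin N → ℂ) (i : Fin N) : vecEntry v i = v i := by simp [vecEntry]

theorem vecEntry_of_le {v : Fin N → ℂ} {i : ℕ} (h : N ≤ i) : vecEntry v i = 0 := by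
  simp [vecEntry, h]

theorem Matrix.IsHermitian.star_matEntry (hA : A.IsHermitian) (i j : ℕ) :
    starRingEnd ℂ (matEntry A i j) = matEntry A j i := by
  by_cases h : i < N ∧ j < N
  · simpa [matEntry, h] using hA.apply ⟨j, h.2⟩ ⟨i, h.1⟩
  · have h' : ¬(j < N ∧ i < N) := fun h' => h h'.symm
    simp [matEntry, h, h']

theorem Matrix.IsHermitian.ofReal_re_matEntry (hA : A.IsHermitian) (i : ℕ) :
    ((matEntry A i i).re : ℂ) = matEntry A i i :=
  Complex.conj_eq_iff_re.1 (hA.star_matEntry i i)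

theorem IsMirrorSymmetric.matEntry_eq (hA : IsMirrorSymmetric A) {i j i' j' : ℕ}
    (hi : i + i' + 1 = N) (hj : j + j' + 1 = N) : matEntry A i j = matEntry A i' j' := by
  have h := isMirrorSymmetric_iff.1 hA ⟨i, by omega⟩ ⟨j, by omega⟩
  have e1 : Fin.rev (⟨i, by omega⟩ : Fin N) = ⟨i', by omega⟩ := by ext; simp; omega
  have e2 : Fin.rev (⟨j, by omega⟩ : Fin N) = ⟨j', by omega⟩ := by ext; simp; omega
  rw [e1, e2] at h
  simpa [matEntry, show i < N by omega, show j < N by omega, show i' < N by omega,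
    show j' < N by omega] using h

theorem vecEntry_comp_rev {v : Fin N → ℂ} {i i' : ℕ} (hi : i + i' + 1 = N) :
    vecEntry (v ∘ Fin.rev) i = vecEntry v i' := by
  have e1 : Fin.rev (⟨i, by omega⟩ : Fin N) = ⟨i', by omega⟩ := by ext; simp; omega
  simp [vecEntry, show i < N by omega, show i' < N by omega, e1]

theorem vecEntry_mulVec (v : Fin N → ℂ) {k : ℕ} (hk : k < N) :
    vecEntry (A.mulVec v) k = ∑ j ∈ Finset.range N, matEntry A k j * vecEntry v j := by
  rw [← Fin.sum_univ_eq_sum_range fun j => matEntry A k j * vecEntry v j]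
  simp [vecEntry, matEntry, hk, Matrix.mulVec, dotProduct]

theorem IsTridiagonal.matEntry_eq_zero (hA : IsTridiagonal A) {i j : ℕ}
    (h : i + 1 < j ∨ j + 1 < i) : matEntry A i j = 0 := by
  rw [matEntry]
  split_ifs with h'
  · exact hA _ _ h
  · rfl

theorem IsTridiagonal.vecEntry_mulVec (hA : IsTridiagonal A) (v : Fin N → ℂ) {k : ℕ}
    (hk : k < N) {s : Finset ℕ} (hs : s ⊆ Finset.range (N + 2))
    (hks : ∀ j, j ≤ k + 1 → k ≤ j + 1 → j ∈ s) :
    vecEntry (A.mulVec v) k = ∑ j ∈ s, matEntry A k j * vecEntry v j := by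
  rw [_root_.vecEntry_mulVec v hk]
  trans ∑ j ∈ Finset.range (N + 2), matEntry A k j * vecEntry v j
  · refine Finset.sum_subset (by simp) fun j _ hj => ?_
    rw [vecEntry_of_le (by simpa using hj), mul_zero]
  · refine (Finset.sum_subset hs fun j _ hj => ?_).symm
    rw [hA.matEntry_eq_zero, zero_mul]
    by_contra! h
    exact hj (hks j (by omega) (by omega))

theorem IsTridiagonal.vecEntry_mulVec_zero (hA : IsTridiagonal A) (v : Fin N → ℂ) (hN : 0 < N) :
    vecEntry (A.mulVec v) 0 = matEntry A 0 0 * vecEntry v 0 + matEntry A 0 1 * vecEntry v 1 := by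
  rw [hA.vecEntry_mulVec v hN (s := {0, 1})]
  · simp
  · intro j; simp; omega
  · intro j; simp; omega

theorem IsTridiagonal.vecEntry_mulVec_succ (hA : IsTridiagonal A) (v : Fin N → ℂ) {k : ℕ}
    (hk : k + 1 < N) :
    vecEntry (A.mulVec v) (k + 1) = matEntry A (k + 1) k * vecEntry v k +
      matEntry A (k + 1) (k + 1) * vecEntry v (k + 1) +
      matEntry A (k + 1) (k + 2) * vecEntry v (k + 2) := by
  rw [hA.vecEntry_mulVec v hk (s := {k, k + 1, k + 2})]
  · simp [add_assoc]
  · intro j; simp; omega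
  · intro j; simp; omega

theorem vecEntry_smul (x : ℂ) (v : Fin N → ℂ) (k : ℕ) :
    vecEntry (x • v) k = x * vecEntry v k := by
  by_cases h : k < N <;> simp [vecEntry, h]

/-- The entries of an eigenvector of a Hermitian tridiagonal matrix are, up to the product of the
preceding superdiagonal entries, the values of the Jacobi polynomials at the eigenvalue. Only the
leading `m × m` block enters, and the superdiagonal entry leaving it. -/
theorem prod_mul_vecEntry_eq (hH : A.IsHermitian) (hT : IsTridiagonal A) {v : Fin N → ℂ} {x : ℝ}
    (hv : A.mulVec v = (x : ℂ) • v) {a c : ℕ → ℝ} {m : ℕ} (hm : m ≤ N)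
    (ha : ∀ k < m, matEntry A k k = a k)
    (hc : ∀ k, k + 1 < m → c k = ‖matEntry A k (k + 1)‖ ^ 2) {k : ℕ} (hk : k ≤ m) :
    (∏ j ∈ Finset.range k, matEntry A j (j + 1)) * vecEntry v k =
      ((jacobiPoly a c k).eval x : ℝ) * vecEntry v 0 := by
  have hv' : ∀ k, vecEntry (A.mulVec v) k = x * vecEntry v k := fun k => by
    rw [hv, vecEntry_smul]
  induction k using Nat.twoStepInduction with
  | zero => simp [jacobiPoly]
  | one =>
    have h := hT.vecEntry_mulVec_zero v (by omega)
    rw [hv', ha 0 (by omega)] at h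
    simp [jacobiPoly]
    linear_combination -h
  | more k ih0 ih1 =>
    have h := hT.vecEntry_mulVec_succ v (k := k) (by omega)
    have h0 := ih0 (by omega)
    have h1 := ih1 (by omega)
    have hck : (c k : ℂ) = matEntry A k (k + 1) * matEntry A (k + 1) k := by
      rw [hc k (by omega), ← hH.star_matEntry k (k + 1), Complex.mul_conj']
      push_cast
      rfl
    rw [hv', ha (k + 1) (by omega)] at h
    rw [Finset.prod_range_succ] at h1 ⊢
    rw [Finset.prod_range_succ]
    simp only [jacobiPoly, eval_sub, eval_mul, eval_X, eval_C]
    push_cast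
    rw [hck]
    linear_combination (-(∏ j ∈ Finset.range k, matEntry A j (j + 1)) * matEntry A k (k + 1)) * h
      + (x - a (k + 1)) * h1 - matEntry A k (k + 1) * matEntry A (k + 1) k * h0

/-- If no superdiagonal entry vanishes, then neither does the first entry of an eigenvector. -/
theorem vecEntry_zero_ne_zero (hH : A.IsHermitian) (hT : IsTridiagonal A)
    (h0 : ∀ k, k + 1 < N → matEntry A k (k + 1) ≠ 0) {v : Fin N → ℂ} {x : ℝ}
    (hv : A.mulVec v = (x : ℂ) • v) (hne : v ≠ 0) : vecEntry v 0 ≠ 0 := by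
  refine fun hz => hne (funext fun i => ?_)
  have h := prod_mul_vecEntry_eq hH hT hv (a := fun k => (matEntry A k k).re)
    (c := fun k => ‖matEntry A k (k + 1)‖ ^ 2) le_rfl
    (fun k _ => (hH.ofReal_re_matEntry k).symm) (fun k _ => rfl) i.2.le
  rw [hz, mul_zero, mul_eq_zero, Finset.prod_eq_zero_iff] at h
  rcases h with ⟨j, hj, hj'⟩ | h
  · exact absurd hj' (h0 j (by have := Finset.mem_range.1 hj; omega))
  · simpa using h

/-- In even dimension `2 (m + 1)`, the eigenvalues of a mirror-symmetric Hermitian tridiagonal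
matrix with (anti)symmetric eigenvector are roots of `q (m + 1) ∓ β q m`, where `β` is the entry
joining the two middle sites. -/
theorem eval_eq_zero_of_even (hH : A.IsHermitian) (hT : IsTridiagonal A) {m : ℕ}
    (hN : N = 2 * (m + 1)) (h0 : ∀ k, k + 1 < N → matEntry A k (k + 1) ≠ 0) {v : Fin N → ℂ}
    {x : ℝ} (hv : A.mulVec v = (x : ℂ) • v) (hne : v ≠ 0) {σ : ℝ}
    (hr : v ∘ Fin.rev = (σ : ℂ) • v) {a c : ℕ → ℝ} {β : ℝ}
    (ha : ∀ k ≤ m, matEntry A k k = a k) (hc : ∀ k < m, c k = ‖matEntry A k (k + 1)‖ ^ 2)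
    (hβ : matEntry A m (m + 1) = β) :
    (jacobiPoly a c (m + 1) - C (σ * β) * jacobiPoly a c m).eval x = 0 := by
  have h := fun k (hk : k ≤ m + 1) => prod_mul_vecEntry_eq hH hT hv (a := a) (c := c)
    (m := m + 1) (by omega) (fun k hk => ha k (by omega)) (fun k hk => hc k (by omega)) hk
  have h1 := h m (by omega)
  have h2 := h (m + 1) le_rfl
  have hmid : vecEntry v (m + 1) = σ * vecEntry v m := by
    rw [← vecEntry_smul, ← hr, vecEntry_comp_rev (i' := m + 1) (by omega)]
  rw [Finset.prod_range_succ, hmid, hβ] at h2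
  have hz := vecEntry_zero_ne_zero hH hT h0 hv hne
  have : (((jacobiPoly a c (m + 1) - C (σ * β) * jacobiPoly a c m).eval x : ℝ) : ℂ) *
      vecEntry v 0 = 0 := by
    simp only [eval_sub, eval_mul, eval_C]
    push_cast
    linear_combination -h2 + (σ * β : ℂ) * h1
  exact_mod_cast (mul_eq_zero.1 this).resolve_right hz

/-- In odd dimension `2 m + 1`, an antisymmetric eigenvector vanishes at the middle site, so that
its eigenvalue is a root of `q m`. -/
theorem eval_eq_zero_of_odd_of_antisymmetric (hH : A.IsHermitian) (hT : IsTridiagonal A) {m : ℕ}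
    (hN : N = 2 * m + 1) (h0 : ∀ k, k + 1 < N → matEntry A k (k + 1) ≠ 0) {v : Fin N → ℂ}
    {x : ℝ} (hv : A.mulVec v = (x : ℂ) • v) (hne : v ≠ 0) (hr : v ∘ Fin.rev = -v) {a c : ℕ → ℝ}
    (ha : ∀ k < m, matEntry A k k = a k)
    (hc : ∀ k, k + 1 < m → c k = ‖matEntry A k (k + 1)‖ ^ 2) :
    (jacobiPoly a c m).eval x = 0 := by
  have h := prod_mul_vecEntry_eq hH hT hv (a := a) (c := c) (m := m) (by omega) ha hc le_rfl
  have hmid : vecEntry v m = 0 := by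
    have h1 : vecEntry v m = -1 * vecEntry v m := by
      rw [← vecEntry_smul, neg_one_smul, ← hr, vecEntry_comp_rev (i' := m) (by omega)]
    linear_combination h1 / 2
  rw [hmid, mul_zero, eq_comm, mul_eq_zero] at h
  exact_mod_cast h.resolve_right (vecEntry_zero_ne_zero hH hT h0 hv hne)

/-- In odd dimension `2 m + 1`, the eigenvalue of a symmetric eigenvector is a root of
`q (m + 1) - c (m - 1) q (m - 1)`, which is the Jacobi polynomial with `c (m - 1)` doubled. -/
theorem eval_eq_zero_of_odd_of_symmetric (hH : A.IsHermitian) (hT : IsTridiagonal A)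
    (hS : IsMirrorSymmetric A) {m : ℕ}
    (hN : N = 2 * m + 1) (h0 : ∀ k, k + 1 < N → matEntry A k (k + 1) ≠ 0) {v : Fin N → ℂ}
    {x : ℝ} (hv : A.mulVec v = (x : ℂ) • v) (hne : v ≠ 0) (hr : v ∘ Fin.rev = v) {a c : ℕ → ℝ}
    (ha : ∀ k ≤ m, matEntry A k k = a k)
    (hc : ∀ k < m, c k = (if k + 1 = m then 2 else 1) * ‖matEntry A k (k + 1)‖ ^ 2) :
    (jacobiPoly a c (m + 1)).eval x = 0 := by
  set c₁ : ℕ → ℝ := fun k => ‖matEntry A k (k + 1)‖ ^ 2 with hc₁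
  have h := fun k (hk : k ≤ m + 1) => prod_mul_vecEntry_eq hH hT hv (a := a) (c := c₁)
    (m := m + 1) (by omega) (fun k hk => ha k (by omega)) (fun k hk => rfl) hk
  have hz := vecEntry_zero_ne_zero hH hT h0 hv hne
  cases m with
  | zero =>
    have h1 := h 1 (by omega)
    rw [vecEntry_of_le (by omega), mul_zero, eq_comm, mul_eq_zero] at h1
    exact_mod_cast h1.resolve_right hz
  | succ p =>
    have hcongr : ∀ k ≤ p + 1, jacobiPoly a c k = jacobiPoly a c₁ k := fun k hk =>
      jacobiPoly.congr (fun _ _ => rfl) fun j hj => by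
        rw [hc j (by omega), if_neg (by omega), one_mul]
    have h1 := h p (by omega)
    have h2 := h (p + 2) le_rfl
    have hmid : vecEntry v (p + 2) = vecEntry v p := by
      conv_rhs => rw [← hr, vecEntry_comp_rev (i' := p + 2) (by omega)]
    have hb : matEntry A (p + 1) (p + 2) = matEntry A (p + 1) p :=
      hS.matEntry_eq (by omega) (by omega)
    have hck : (c₁ p : ℂ) = matEntry A p (p + 1) * matEntry A (p + 1) p := by
      rw [hc₁, ← hH.star_matEntry p (p + 1), Complex.mul_conj']
      push_cast
      rfl
    rw [Finset.prod_range_succ, Finset.prod_range_succ, hmid, hb] at h2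
    have : (((jacobiPoly a c (p + 2)).eval x : ℝ) : ℂ) * vecEntry v 0 = 0 := by
      rw [jacobiPoly] at h2 ⊢
      rw [hcongr _ le_rfl, hcongr _ (by omega), hc p (by omega), if_pos rfl]
      simp only [eval_sub, eval_mul, eval_X, eval_C] at h2 ⊢
      push_cast at h2 ⊢
      rw [hc₁] at hck
      push_cast at hck
      simp only [hc₁] at h2 h1
      push_cast at h2
      rw [hck] at h2 ⊢
      linear_combination -h2 + matEntry A p (p + 1) * matEntry A (p + 1) p * h1
    exact_mod_cast (mul_eq_zero.1 this).resolve_right hz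

end Tridiagonal

/-! ### Deformations of mirror-symmetric tridiagonal matrices -/

section Deformation

variable {N : ℕ} {A : Matrix (Fin N) (Fin N) ℂ}

/-- The zeros next to the diagonal can be removed by a small perturbation. -/
theorem exists_superdiagonal_ne_zero (hH : A.IsHermitian) (hT : IsTridiagonal A)
    (hS : IsMirrorSymmetric A) {ε : ℝ} (hε : 0 < ε) :
    ∃ B : Matrix (Fin N) (Fin N) ℂ, B.IsHermitian ∧ IsTridiagonal B ∧ IsMirrorSymmetric B ∧
      ((∀ i j, (A i j).im = 0) → ∀ i j, (B i j).im = 0) ∧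
      (∀ k, k + 1 < N → matEntry B k (k + 1) ≠ 0) ∧ ∀ i j, ‖B i j - A i j‖ < ε := by
  let p : Fin N → Fin N → Prop := fun i j =>
    ((i : ℕ) + 1 = j ∨ (j : ℕ) + 1 = i) ∧ A i j = 0
  have hAji : ∀ i j, A j i = 0 ↔ A i j = 0 := fun i j => by
    rw [← hH.apply i j, star_eq_zero]
  have hpsymm : ∀ i j, p j i ↔ p i j := fun i j => by
    simp only [p, hAji i j, or_comm]
  have hprev : ∀ i j : Fin N, p i.rev j.rev ↔ p i j := fun i j => by
    simp only [p, ← isMirrorSymmetric_iff.1 hS i j, Fin.val_rev]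
    refine and_congr_left fun _ => ?_
    omega
  classical
  refine ⟨Matrix.of fun i j => A i j + if p i j then ((ε / 2 : ℝ) : ℂ) else 0, ?_, ?_, ?_, ?_, ?_,
    fun i j => ?_⟩
  · ext i j
    simp only [Matrix.conjTranspose_apply, Matrix.of_apply, star_add, hpsymm i j, hH.apply i j]
    split_ifs <;> simp
  · intro i j hij
    rw [Matrix.of_apply, if_neg (fun h : p i j => by have := h.1; omega), hT i j hij, add_zero]
  · rw [isMirrorSymmetric_iff]
    intro i j
    simp only [Matrix.of_apply, hprev, ← isMirrorSymmetric_iff.1 hS i j]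
  · intro h i j
    rw [Matrix.of_apply, Complex.add_im, h]
    split_ifs <;> simp
  · intro k hk
    have hε' : (ε : ℂ) ≠ 0 := by exact_mod_cast hε.ne'
    by_cases h : A ⟨k, by omega⟩ ⟨k + 1, hk⟩ = 0
    · simp [matEntry, hk, show k < N by omega, p, h, hε']
    · simp [matEntry, hk, show k < N by omega, p, h]
  · rw [Matrix.of_apply, add_sub_cancel_left]
    split_ifs
    · rw [Complex.norm_real, Real.norm_of_nonneg (by positivity)]
      linarith
    · simpa using hε

/-- The mirror-symmetric deformation of a matrix `A` whose diagonal entries in the first half are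
`α k`, and whose entry at the sites `k`, `k + 1` of the first half is scaled by `r k`. Each
site and each bond is referred to by the smaller of its own index and that of its mirror image. -/
def mirrorDeform (A : Matrix (Fin N) (Fin N) ℂ) (α r : ℕ → ℝ) : Matrix (Fin N) (Fin N) ℂ :=
  Matrix.of fun i j =>
    if i = j then (α (min (i : ℕ) i.rev) : ℂ)
    else (r (min (min (i : ℕ) j) (min (i.rev : ℕ) j.rev)) : ℂ) * A i j

theorem mirrorDeform_isHermitian (hH : A.IsHermitian) (α r : ℕ → ℝ) :
    (mirrorDeform A α r).IsHermitian := by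
  ext i j
  by_cases h : i = j
  · simp [mirrorDeform, h]
  · simp only [Matrix.conjTranspose_apply, mirrorDeform, Matrix.of_apply, if_neg h,
      if_neg (Ne.symm h), star_mul', hH.apply i j, Complex.star_def, Complex.conj_ofReal]
    rw [min_comm (j : ℕ) i, min_comm (j.rev : ℕ) i.rev]

theorem mirrorDeform_isTridiagonal (hT : IsTridiagonal A) (α r : ℕ → ℝ) :
    IsTridiagonal (mirrorDeform A α r) := by
  intro i j hij
  have h : i ≠ j := by rintro rfl; omega
  simp [mirrorDeform, h, hT i j hij]

theorem mirrorDeform_isMirrorSymmetric (hS : IsMirrorSymmetric A) (α r : ℕ → ℝ) :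
    IsMirrorSymmetric (mirrorDeform A α r) := by
  rw [isMirrorSymmetric_iff]
  intro i j
  simp only [mirrorDeform, Matrix.of_apply, Fin.rev_inj, Fin.rev_rev,
    ← isMirrorSymmetric_iff.1 hS i j]
  rw [min_comm (i.rev : ℕ) i, min_comm (min (i.rev : ℕ) j.rev)]

theorem mirrorDeform_im_eq_zero (hA : ∀ i j, (A i j).im = 0) (α r : ℕ → ℝ) (i j : Fin N) :
    (mirrorDeform A α r i j).im = 0 := by
  by_cases h : i = j <;> simp [mirrorDeform, h, hA]

theorem matEntry_mirrorDeform_self (α r : ℕ → ℝ) {k : ℕ} (hk : 2 * k + 1 ≤ N) :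
    matEntry (mirrorDeform A α r) k k = α k := by
  have h : min k (N - (k + 1)) = k := by omega
  simp [matEntry, mirrorDeform, show k < N by omega, h]

theorem matEntry_mirrorDeform_succ (α r : ℕ → ℝ) {k : ℕ} (hk : 2 * k + 2 ≤ N) :
    matEntry (mirrorDeform A α r) k (k + 1) = r k * matEntry A k (k + 1) := by
  have h : min (min k (k + 1)) (min (N - (k + 1)) (N - (k + 1 + 1))) = k := by omega
  simp only [matEntry, mirrorDeform, show k < N by omega, show k + 1 < N by omega, and_self,
    dite_true, Matrix.of_apply, Fin.mk.injEq, Fin.val_rev, h]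
  simp

theorem matEntry_mirrorDeform_succ_ne_zero (α : ℕ → ℝ) {r : ℕ → ℝ}
    (hr : ∀ k, 2 * k + 2 ≤ N → r k ≠ 0) (h0 : ∀ k, k + 1 < N → matEntry A k (k + 1) ≠ 0) (k : ℕ)
    (hk : k + 1 < N) : matEntry (mirrorDeform A α r) k (k + 1) ≠ 0 := by
  have h := h0 k hk
  simp only [matEntry, mirrorDeform, show k < N by omega, hk, and_self,
    dite_true, Matrix.of_apply, Fin.mk.injEq, Fin.val_rev] at h ⊢
  rw [if_neg (by omega)]
  refine mul_ne_zero (Complex.ofReal_ne_zero.2 (hr _ ?_)) h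
  omega

theorem tendsto_mirrorDeform {ι : Type*} {l : Filter ι} (hH : A.IsHermitian)
    (hT : IsTridiagonal A) (hS : IsMirrorSymmetric A) {α r : ι → ℕ → ℝ}
    (hα : ∀ k, 2 * k + 1 ≤ N → Tendsto (fun t => α t k) l (𝓝 (matEntry A k k).re))
    (hr : ∀ k, 2 * k + 2 ≤ N → Tendsto (fun t => r t k) l (𝓝 1)) (i j : Fin N) :
    Tendsto (fun t => mirrorDeform A (α t) (r t) i j) l (𝓝 (A i j)) := by
  by_cases h : i = j
  · subst h
    have hfold : matEntry A (min (i : ℕ) i.rev) (min (i : ℕ) i.rev) = A i i := by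
      rcases min_choice (i : ℕ) i.rev with h | h <;> rw [h, matEntry_val]
      exact (isMirrorSymmetric_iff.1 hS i i).symm
    have h1 := hα (min (i : ℕ) i.rev) (by simp only [Fin.val_rev]; omega)
    have h2 := (Complex.continuous_ofReal.tendsto _).comp h1
    rw [hH.ofReal_re_matEntry, hfold] at h2
    simp only [mirrorDeform, Matrix.of_apply, if_true]
    exact h2
  · by_cases hij : (i : ℕ) + 1 < j ∨ (j : ℕ) + 1 < i
    · simpa [mirrorDeform, h, hT i j hij] using tendsto_const_nhds
    · have hne : (i : ℕ) ≠ j := fun h' => h (Fin.ext h')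
      have h1 := hr (min (min (i : ℕ) j) (min (i.rev : ℕ) j.rev))
        (by simp only [Fin.val_rev]; omega)
      have h2 := ((Complex.continuous_ofReal.tendsto _).comp h1).mul_const (A i j)
      simpa [mirrorDeform, h] using h2

theorem eventually_ne_zero_of_tendsto_one {ι : Type*} {l : Filter ι} {r : ι → ℕ → ℝ}
    (hr : ∀ k, 2 * k + 2 ≤ N → Tendsto (fun t => r t k) l (𝓝 1)) :
    ∀ᶠ t in l, ∀ k, 2 * k + 2 ≤ N → r t k ≠ 0 := by
  have h : ∀ᶠ t in l, ∀ k ∈ Finset.range N, 2 * k + 2 ≤ N → r t k ≠ 0 := by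
    rw [Finset.eventually_all]
    intro k _
    by_cases hk : 2 * k + 2 ≤ N
    · filter_upwards [(hr k hk).eventually_ne one_ne_zero] with t ht _ using ht
    · exact Eventually.of_forall fun t h => absurd h hk
  filter_upwards [h] with t ht k hk using ht k (Finset.mem_range.2 (by omega)) hk

theorem tendsto_sqrt_div_one {ι : Type*} {l : Filter ι} {x : ι → ℝ} {y : ℝ} (hy : y ≠ 0)
    (hx : Tendsto x l (𝓝 y)) : Tendsto (fun t => √(x t / y)) l (𝓝 1) := by
  have h := (Real.continuous_sqrt.tendsto _).comp (hx.div_const y)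
  rwa [div_self hy, Real.sqrt_one] at h

theorem eventually_forall_lt_pos {ι : Type*} {l : Filter ι} {c' : ι → ℕ → ℝ} {c : ℕ → ℝ} {m : ℕ}
    (hc : ∀ k < m, 0 < c k) (hc' : ∀ k, Tendsto (fun t => c' t k) l (𝓝 (c k))) :
    ∀ᶠ t in l, ∀ k < m, 0 < c' t k := by
  have h : ∀ᶠ t in l, ∀ k ∈ Finset.range m, 0 < c' t k :=
    (Finset.eventually_all _).2 fun k hk =>
      (hc' k).eventually_const_lt (hc k (Finset.mem_range.1 hk))
  simpa using h

theorem norm_sq_sqrt_div_mul {x y : ℝ} (hx : 0 < x) (hy : 0 < y) (b : ℂ) :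
    ‖((√(x / y) : ℝ) : ℂ) * b‖ ^ 2 = x / y * ‖b‖ ^ 2 := by
  rw [norm_mul, mul_pow, Complex.norm_real, Real.norm_of_nonneg (Real.sqrt_nonneg _),
    Real.sq_sqrt (div_pos hx hy).le]

/-- In odd dimension, the polynomials of the symmetric and antisymmetric sectors are two
consecutive Jacobi polynomials, so that rounding their roots can be undone by the Euclidean
algorithm. -/
theorem exists_deformation_of_odd (hH : A.IsHermitian) (hT : IsTridiagonal A)
    (hS : IsMirrorSymmetric A) (h0 : ∀ k, k + 1 < N → matEntry A k (k + 1) ≠ 0) {m : ℕ}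
    (hN : N = 2 * m + 1) :
    ∃ α r : ℝ → ℕ → ℝ,
      (∀ k, 2 * k + 1 ≤ N → Tendsto (fun δ => α δ k) (𝓝[>] 0) (𝓝 (matEntry A k k).re)) ∧
      (∀ k, 2 * k + 2 ≤ N → Tendsto (fun δ => r δ k) (𝓝[>] 0) (𝓝 1)) ∧
      ∀ᶠ δ in 𝓝[>] 0, HasPerfectStateTransfer (mirrorDeform A (α δ) (r δ)) := by
  let a : ℕ → ℝ := fun k => (matEntry A k k).re
  let c : ℕ → ℝ := fun k => (if k + 1 = m then 2 else 1) * ‖matEntry A k (k + 1)‖ ^ 2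
  have hc : ∀ k < m, 0 < c k := fun k hk => by
    have := norm_pos_iff.2 (h0 k (by omega))
    simp only [c]
    split_ifs <;> positivity
  obtain ⟨P, hPm, hPd, hPr, hP⟩ := exists_coeffTendsto_rounded_roots
    (jacobiPoly.splits (a := a) (c := c) (n := m + 1) fun k hk => hc k (by omega))
    (jacobiPoly.monic _ _ _) 0
  obtain ⟨Q, hQm, hQd, hQr, hQ⟩ := exists_coeffTendsto_rounded_roots
    (jacobiPoly.splits (a := a) (c := c) (n := m) fun k hk => hc k (by omega))
    (jacobiPoly.monic _ _ _) 1
  simp only [jacobiPoly.natDegree_eq] at hPd hQd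
  obtain ⟨a', c', ha', hc', h⟩ := exists_tendsto_eventually_jacobiPoly_eq
    (fun k hk => (hc k hk).ne') hP hQ (Eventually.of_forall fun δ => ⟨hPm δ, hPd δ⟩)
    (Eventually.of_forall fun δ => ⟨hQm δ, hQd δ⟩)
  let r : ℝ → ℕ → ℝ := fun δ k => √(c' δ k / c k)
  have hr : ∀ k, 2 * k + 2 ≤ N → Tendsto (fun δ => r δ k) (𝓝[>] 0) (𝓝 1) := fun k hk =>
    tendsto_sqrt_div_one (hc k (by omega)).ne' (hc' k)
  refine ⟨a', r, fun k _ => ha' k, hr, ?_⟩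
  filter_upwards [h, eventually_forall_lt_pos hc hc', eventually_ne_zero_of_tendsto_one hr,
    self_mem_nhdsWithin] with δ hδ hpos hr0 (hδ0 : 0 < δ)
  have hH' := mirrorDeform_isHermitian hH (a' δ) (r δ)
  have hT' := mirrorDeform_isTridiagonal hT (a' δ) (r δ)
  have hS' := mirrorDeform_isMirrorSymmetric hS (a' δ) (r δ)
  have h0' := matEntry_mirrorDeform_succ_ne_zero (a' δ) hr0 h0
  have hdiag : ∀ k ≤ m, matEntry (mirrorDeform A (a' δ) (r δ)) k k = a' δ k := fun k hk =>
    matEntry_mirrorDeform_self _ _ (by omega)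
  have hsup : ∀ k < m, c' δ k =
      (if k + 1 = m then 2 else 1) *
        ‖matEntry (mirrorDeform A (a' δ) (r δ)) k (k + 1)‖ ^ 2 := fun k hk => by
    rw [matEntry_mirrorDeform_succ _ _ (by omega), norm_sq_sqrt_div_mul (hpos k hk) (hc k hk),
      mul_left_comm]
    exact (div_mul_cancel₀ _ (hc k hk).ne').symm
  refine hasPerfectStateTransfer_of_eigenvalues hH' hS' hδ0 (fun x v hv hx hrev => ?_)
    fun x v hv hx hrev => ?_
  · have := eval_eq_zero_of_odd_of_symmetric hH' hT' hS' hN h0' hx hv hrev hdiag hsup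
    rw [hδ.1] at this
    simpa using hPr δ x this
  · have := eval_eq_zero_of_odd_of_antisymmetric hH' hT' hN h0' hx hv hrev
      (a := a' δ) (c := c' δ) (fun k hk => hdiag k hk.le) fun k hk => by rw [hsup k (by omega), if_neg (by omega), one_mul]
    rw [hδ.2] at this
    simpa using hQr δ x this

/-- In even dimension, the polynomials `p₊`, `p₋` of the symmetric and antisymmetric sectors are
`q (m + 1) ∓ β q m`, so that half their sum and a multiple of their difference are consecutive
Jacobi polynomials. -/
theorem exists_deformation_of_even (hH : A.IsHermitian) (hT : IsTridiagonal A)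
    (hS : IsMirrorSymmetric A) (h0 : ∀ k, k + 1 < N → matEntry A k (k + 1) ≠ 0) {m : ℕ}
    (hN : N = 2 * (m + 1)) :
    ∃ α r : ℝ → ℕ → ℝ,
      (∀ k, 2 * k + 1 ≤ N → Tendsto (fun δ => α δ k) (𝓝[>] 0) (𝓝 (matEntry A k k).re)) ∧
      (∀ k, 2 * k + 2 ≤ N → Tendsto (fun δ => r δ k) (𝓝[>] 0) (𝓝 1)) ∧
      ∀ᶠ δ in 𝓝[>] 0, HasPerfectStateTransfer (mirrorDeform A (α δ) (r δ)) := by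
  let a : ℕ → ℝ := fun k => (matEntry A k k).re
  let c : ℕ → ℝ := fun k => ‖matEntry A k (k + 1)‖ ^ 2
  have hc : ∀ k < m, 0 < c k := fun k hk => by
    have := norm_pos_iff.2 (h0 k (by omega))
    positivity
  -- The middle entry is real, since the mirror exchanges it with its conjugate.
  obtain ⟨β, hβ⟩ : ∃ β : ℝ, matEntry A m (m + 1) = β := by
    refine ⟨_, (Complex.conj_eq_iff_re.1 ?_).symm⟩
    rw [hH.star_matEntry]
    exact hS.matEntry_eq (by omega) (by omega)
  have hβ0 : β ≠ 0 := fun h => h0 m (by omega) (by rw [hβ, h, Complex.ofReal_zero])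
  have hsector : ∀ (t : ℝ) (s : ℤ), ∃ P : ℝ → ℝ[X], (∀ δ, (P δ).Monic) ∧
      (∀ δ, (P δ).natDegree = m + 1) ∧
      (∀ δ x, (P δ).IsRoot x → ∃ n : ℤ, x = δ * (2 * n + s)) ∧
      CoeffTendsto P (𝓝[>] 0) (jacobiPoly a c (m + 1) - C t * jacobiPoly a c m) := by
    intro t s
    rw [jacobiPoly_succ_sub_C_mul]
    simpa only [jacobiPoly.natDegree_eq] using exists_coeffTendsto_rounded_roots
      (jacobiPoly.splits (a := Function.update a m (a m + t)) (c := c) (n := m + 1)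
        fun k hk => hc k (by omega)) (jacobiPoly.monic _ _ _) s
  obtain ⟨P, hPm, hPd, hPr, hP⟩ := hsector (1 * β) 0
  obtain ⟨Q, hQm, hQd, hQr, hQ⟩ := hsector (-1 * β) 1
  have hPc : ∀ δ, (P δ).coeff (m + 1) = 1 := fun δ => by simpa [hPd] using (hPm δ).coeff_natDegree
  have hQc : ∀ δ, (Q δ).coeff (m + 1) = 1 := fun δ => by simpa [hQd] using (hQm δ).coeff_natDegree
  let H : ℝ → ℝ[X] := fun δ => C (1 / 2) * (P δ + Q δ)
  let D : ℝ → ℝ[X] := fun δ => C (1 / 2) * (Q δ - P δ)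
  have hhalf : (C (1 / 2) : ℝ[X]) * 2 = 1 := by
    rw [← C_ofNat, ← C_mul]; norm_num
  have hHlim : CoeffTendsto H (𝓝[>] 0) (jacobiPoly a c (m + 1)) := by
    convert (CoeffTendsto.const (C (1 / 2))).mul (hP.add hQ) using 1
    simp only [neg_mul, one_mul, C_neg]
    linear_combination -jacobiPoly a c (m + 1) * hhalf
  have hDlim : CoeffTendsto D (𝓝[>] 0) (C β * jacobiPoly a c m) := by
    convert (CoeffTendsto.const (C (1 / 2))).mul (hQ.sub hP) using 1
    simp only [neg_mul, one_mul, C_neg]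
    linear_combination -C β * jacobiPoly a c m * hhalf
  have hHm : ∀ δ, (H δ).Monic ∧ (H δ).natDegree = m + 1 := by
    intro δ
    have h1 : (H δ).coeff (m + 1) = 1 := by
      simp only [H, coeff_C_mul, coeff_add, hPc, hQc]; norm_num
    have hle : (H δ).natDegree ≤ m + 1 :=
      (natDegree_C_mul_le _ _).trans (natDegree_add_le_of_degree_le (hPd δ).le (hQd δ).le)
    exact ⟨monic_of_natDegree_le_of_coeff_eq_one _ hle h1,
      natDegree_eq_of_le_of_coeff_ne_zero hle (by rw [h1]; exact one_ne_zero)⟩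
  have hDd : ∀ δ, (D δ).natDegree ≤ m := by
    intro δ
    rw [natDegree_le_iff_coeff_eq_zero]
    intro k hk
    rcases (show m + 1 ≤ k from hk).eq_or_lt with rfl | hk
    · simp [D, hPc, hQc]
    · rw [coeff_C_mul, coeff_sub, coeff_eq_zero_of_natDegree_lt (by rw [hQd]; exact hk),
        coeff_eq_zero_of_natDegree_lt (by rw [hPd]; exact hk), sub_zero, mul_zero]
  let β' : ℝ → ℝ := fun δ => (D δ).coeff m
  have hβ' : Tendsto β' (𝓝[>] 0) (𝓝 β) := by
    have h1 : (jacobiPoly a c m).coeff m = 1 := by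
      simpa [jacobiPoly.natDegree_eq] using (jacobiPoly.monic a c m).coeff_natDegree
    simpa [h1] using hDlim m
  have hβ'0 : ∀ᶠ δ in 𝓝[>] 0, β' δ ≠ 0 := hβ'.eventually_ne hβ0
  have hRlim : CoeffTendsto (fun δ => C (β' δ)⁻¹ * D δ) (𝓝[>] 0) (jacobiPoly a c m) := by
    have h := (CoeffTendsto.C (hβ'.inv₀ hβ0)).mul hDlim
    rwa [← mul_assoc, ← C_mul, inv_mul_cancel₀ hβ0, C_1, one_mul] at h
  have hRm : ∀ᶠ δ in 𝓝[>] 0, (C (β' δ)⁻¹ * D δ).Monic ∧ (C (β' δ)⁻¹ * D δ).natDegree = m := by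
    filter_upwards [hβ'0] with δ hδ
    have h1 : (C (β' δ)⁻¹ * D δ).coeff m = 1 := by
      rw [coeff_C_mul]; exact inv_mul_cancel₀ hδ
    have hle : (C (β' δ)⁻¹ * D δ).natDegree ≤ m := (natDegree_C_mul_le _ _).trans (hDd δ)
    exact ⟨monic_of_natDegree_le_of_coeff_eq_one _ hle h1,
      natDegree_eq_of_le_of_coeff_ne_zero hle (by rw [h1]; exact one_ne_zero)⟩
  obtain ⟨a', c', ha', hc', h⟩ := exists_tendsto_eventually_jacobiPoly_eq
    (fun k hk => (hc k hk).ne') hHlim hRlim (Eventually.of_forall hHm) hRm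
  let r : ℝ → ℕ → ℝ := fun δ k => if k = m then β' δ / β else √(c' δ k / c k)
  have hr : ∀ k, 2 * k + 2 ≤ N → Tendsto (fun δ => r δ k) (𝓝[>] 0) (𝓝 1) := by
    intro k hk
    rcases eq_or_ne k m with rfl | hkm
    · simpa [r, div_self hβ0] using hβ'.div_const β
    · simpa only [r, if_neg hkm] using tendsto_sqrt_div_one (hc k (by omega)).ne' (hc' k)
  refine ⟨a', r, fun k _ => ha' k, hr, ?_⟩
  filter_upwards [h, eventually_forall_lt_pos hc hc', eventually_ne_zero_of_tendsto_one hr, hβ'0,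
    self_mem_nhdsWithin] with δ hδ hpos hr0 hβδ (hδ0 : 0 < δ)
  have hH' := mirrorDeform_isHermitian hH (a' δ) (r δ)
  have hT' := mirrorDeform_isTridiagonal hT (a' δ) (r δ)
  have hS' := mirrorDeform_isMirrorSymmetric hS (a' δ) (r δ)
  have h0' := matEntry_mirrorDeform_succ_ne_zero (a' δ) hr0 h0
  have hdiag : ∀ k ≤ m, matEntry (mirrorDeform A (a' δ) (r δ)) k k = a' δ k := fun k hk =>
    matEntry_mirrorDeform_self _ _ (by omega)
  have hsup : ∀ k < m, c' δ k =
      ‖matEntry (mirrorDeform A (a' δ) (r δ)) k (k + 1)‖ ^ 2 := fun k hk => by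
    rw [matEntry_mirrorDeform_succ _ _ (by omega)]
    simp only [r, if_neg hk.ne]
    rw [norm_sq_sqrt_div_mul (hpos k hk) (hc k hk)]
    exact (div_mul_cancel₀ _ (hc k hk).ne').symm
  have hmid : matEntry (mirrorDeform A (a' δ) (r δ)) m (m + 1) = (β' δ : ℂ) := by
    rw [matEntry_mirrorDeform_succ _ _ (by omega), hβ]
    simp only [r, if_true]
    rw [← Complex.ofReal_mul, div_mul_cancel₀ _ hβ0]
  have hroot : ∀ (σ x : ℝ) (v : Fin N → ℂ), v ≠ 0 →
      (mirrorDeform A (a' δ) (r δ)).mulVec v = (x : ℂ) • v → v ∘ Fin.rev = (σ : ℂ) • v →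
      (H δ - C σ * D δ).eval x = 0 := by
    intro σ x v hv hx hrev
    have h1 := eval_eq_zero_of_even hH' hT' hN h0' hx hv hrev hdiag hsup hmid
    rwa [hδ.1, hδ.2, C_mul, mul_assoc, ← mul_assoc (C (β' δ)), ← C_mul, mul_inv_cancel₀ hβδ, C_1,
      one_mul] at h1
  refine hasPerfectStateTransfer_of_eigenvalues hH' hS' hδ0 (fun x v hv hx hrev => ?_)
    fun x v hv hx hrev => ?_
  · have h1 := hroot 1 x v hv hx (by simpa using hrev)
    have h2 : H δ - C 1 * D δ = P δ := by
      simp only [H, D, C_1]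
      linear_combination P δ * hhalf
    rw [h2] at h1
    simpa using hPr δ x h1
  · have h1 := hroot (-1) x v hv hx (by simpa using hrev)
    have h2 : H δ - C (-1) * D δ = Q δ := by
      simp only [H, D, C_neg, C_1]
      linear_combination Q δ * hhalf
    rw [h2] at h1
    simpa using hQr δ x h1

end Deformation

theorem mainTheorem4 (N : ℕ) (A : Matrix (Fin N) (Fin N) ℂ)
    (hHerm : A.IsHermitian) (hTri : IsTridiagonal A) (hSymm : IsMirrorSymmetric A)
    (ε : ℝ) (hε : 0 < ε) :
    ∃ A' : Matrix (Fin N) (Fin N) ℂ,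
      A'.IsHermitian ∧ IsTridiagonal A' ∧ IsMirrorSymmetric A' ∧
      ((∀ i j, (A i j).im = 0) → ∀ i j, (A' i j).im = 0) ∧
      HasPerfectStateTransfer A' ∧
      ∀ i j, ‖A' i j - A i j‖ < ε := by
  obtain ⟨B, hH, hT, hS, hreal, h0, hBA⟩ :=
    exists_superdiagonal_ne_zero hHerm hTri hSymm (half_pos hε)
  obtain ⟨α, r, hα, hr, hpst⟩ : ∃ α r : ℝ → ℕ → ℝ,
      (∀ k, 2 * k + 1 ≤ N → Tendsto (fun δ => α δ k) (𝓝[>] 0) (𝓝 (matEntry B k k).re)) ∧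
      (∀ k, 2 * k + 2 ≤ N → Tendsto (fun δ => r δ k) (𝓝[>] 0) (𝓝 1)) ∧
      ∀ᶠ δ in 𝓝[>] 0, HasPerfectStateTransfer (mirrorDeform B (α δ) (r δ)) := by
    obtain ⟨m, hm | hm⟩ := Nat.even_or_odd' N
    · rcases m with _ | m
      · refine ⟨0, 0, fun k hk => by omega, fun k hk => by omega, Eventually.of_forall fun δ => ?_⟩
        subst hm
        exact ⟨1, one_pos, 0, fun Ψ => funext fun i => i.elim0⟩
      · exact exists_deformation_of_even hH hT hS h0 hm
    · exact exists_deformation_of_odd hH hT hS h0 hm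
  have hclose : ∀ᶠ δ in 𝓝[>] (0 : ℝ), ∀ i j,
      ‖mirrorDeform B (α δ) (r δ) i j - B i j‖ < ε / 2 := by
    simp only [eventually_all]
    intro i j
    have h := tendsto_iff_norm_sub_tendsto_zero.1 (tendsto_mirrorDeform hH hT hS hα hr i j)
    exact h.eventually_lt_const (half_pos hε)
  obtain ⟨δ, hδ, hδB⟩ := (hpst.and hclose).exists
  refine ⟨mirrorDeform B (α δ) (r δ), mirrorDeform_isHermitian hH _ _,
    mirrorDeform_isTridiagonal hT _ _, mirrorDeform_isMirrorSymmetric hS _ _,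
    fun h => mirrorDeform_im_eq_zero (hreal h) _ _, hδ, fun i j => ?_⟩
  calc _ = ‖(mirrorDeform B (α δ) (r δ) i j - B i j) + (B i j - A i j)‖ := by
        rw [sub_add_sub_cancel]
    _ < ε := (norm_add_le _ _).trans_lt (by linarith [hδB i j, hBA i j])
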